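/- Setting. There are $M$ players and $K$ arms, and a horizon $T\ge 1$. A problem instance (MPMAB instance) assigns to every arm $i\in[K]$ and player $p\in[M]$ a reward distribution $\mathcal D_i^p$ supported in $[0,1]$, with mean $\mu_i^p$; it is Bernoulli if every $\mathcal D_i^p$ is a Bernoulli distribution. For $\epsilon\ge 0$ it is an $\epsilon$-MPMAB instance if $|\mu_i^p-\mu_i^q|\le\epsilon$ for all arms $i$ and all players $p,q$. Put $\mu_*^p=\max_i\mu_i^p$, $\Delta_i^p=\mu_*^p-\mu_i^p$, $\Delta_i^{\min}=\min_p\Delta_i^p$, and for $\eta \ge 0$ let $\mathcal I_\eta=\{i\in[K]:\exists p\in[M],\ \Delta_i^p>5\eta\}$, with complement $\mathcal I_\eta^C=[K]\setminus\mathcal I_\eta$. An algorithm with horizon $T$ is a sequence of conditional distributions $\pi_t$, $t=1,\dots,T$, of the $M$ players' arms in round $t$ given all players' arms and rewards in rounds $1,\dots,t-1$; given the pulled arms $(i_t^p)_p$, the rewards $r_t^p\sim\mathcal D^p_{i_t^p}$ are drawn independently. Let $n_i^p(T)$ be the number of pulls of arm $i$ by player $p$ in the $T$ rounds. The (expected collective)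 regret of the algorithm on the instance is $\mathbb E[\mathcal R(T)]=\sum_{p\in[M]}\sum_{i\in[K]}\Delta_i^p\,\mathbb E[n_i^p(T)]$. Theorem. Fix $\epsilon\ge 0$ and $\alpha,C>0$. Let $\mathcal A$ be an algorithm with horizon $T$ whose regret is at most $C\,T^{1-\alpha}$ on every $\epsilon$-MPMAB instance with $M$ players and $K$ arms. Then for every Bernoulli $\frac{\epsilon}{2}$-MPMAB instance $\mu=(\mu_i^p)_{i\in[K],p\in[M]}$ with $\mu_i^p\in[\frac{15}{32},\frac{17}{32}]$ for all $i$ and $p$, the regret of $\mathcal A$ on $\mu$ satisfies $$\mathbb E_\mu[\mathcal R(T)]\ \ge\ \sum_{i\in\mathcal I_{\epsilon/20}^C}\ \sum_{p\in[M]:\,\Delta_i^p>0}\frac{\ln\!\big(\Delta_i^pT^\alpha/(8C)\big)}{12\,\Delta_i^p}\ +\ \sum_{i\in\mathcal I_{\epsilon/20}:\,\Delta_i^{\min}>0}\frac{\ln\!\big(\Delta_i^{\min}T^\alpha/(8C)\big)}{12\,\Delta_i^{\min}} .$$ -/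

import Mathlib

open MeasureTheory ProbabilityTheory

noncomputable section

namespace MPMAB

/-- A multi-player multi-armed bandit problem instance with `M` players and `K` arms:
player `p` pulling arm `i` receives a reward drawn from `dist i p`, a probability
distribution supported in `[0, 1]`. -/
structure ProblemInstance (M K : ℕ) where
  dist : Fin K → Fin M → Measure ℝ
  isProbabilityMeasure_dist : ∀ i p, IsProbabilityMeasure (dist i p)
  dist_compl_Icc : ∀ i p, dist i p (Set.Icc (0 : ℝ) 1)ᶜ = 0

attribute [instance] ProblemInstance.isProbabilityMeasure_dist

namespace ProblemInstance

variable {M K : ℕ} (E : ProblemInstance M K)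

/-- The mean reward `μ_i^p` of arm `i` for player `p`. -/
def mean (i : Fin K) (p : Fin M) : ℝ := ∫ x, x ∂(E.dist i p)

/-- The optimal mean reward `μ_*^p = max_i μ_i^p` of player `p`. -/
def optMean (p : Fin M) : ℝ := ⨆ i, E.mean i p

/-- The suboptimality gap `Δ_i^p = μ_*^p - μ_i^p`. -/
def gap (i : Fin K) (p : Fin M) : ℝ := E.optMean p - E.mean i p

/-- The minimal gap `Δ_i^min = min_p Δ_i^p`. -/
def minGap (i : Fin K) : ℝ := ⨅ p, E.gap i p

/-- `E` is an `ε`-MPMAB problem instance: for every arm, the mean rewards of any two players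
differ by at most `ε`. -/
def IsDissimilar (ε : ℝ) : Prop :=
  ∀ p q : Fin M, ∀ i : Fin K, |E.mean i p - E.mean i q| ≤ ε

/-- All the reward distributions are Bernoulli distributions on `{0, 1}`. -/
def IsBernoulli : Prop :=
  ∀ i p, ∃ θ : unitInterval, E.dist i p = bernoulliMeasure (1 : ℝ) 0 θ

open Classical in
/-- The set of subpar arms `I_η = {i | ∃ p, μ_*^p - μ_i^p > 5 η}`. -/
def subparArms (η : ℝ) : Finset (Fin K) :=
  {i : Fin K | ∃ p : Fin M, E.optMean p - E.mean i p > 5 * η}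

/-- The joint law of the rewards of all players in one round, given the arms they pull: the
players' rewards are drawn independently. -/
def rewardKernel : Kernel (Fin M → Fin K) (Fin M → ℝ) :=
  Kernel.ofFunOfCountable fun a => Measure.pi fun p => E.dist (a p) p

instance : IsMarkovKernel E.rewardKernel :=
  ⟨fun a => inferInstanceAs (IsProbabilityMeasure (Measure.pi fun p => E.dist (a p) p))⟩

end ProblemInstance

/-- What is observed in one round: the arms pulled and the rewards received by all players. -/
abbrev Round (M K : ℕ) : Type := (Fin M → Fin K) × (Fin M → ℝ)

/-- The record of `t` rounds. -/
abbrev History (M K t : ℕ) : Type := Fin t → Round M K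

/-- The number `n_i^p(t)` of pulls of arm `i` by player `p` in a history of `t` rounds. -/
def pulls {M K t : ℕ} (i : Fin K) (p : Fin M) (h : History M K t) : ℕ :=
  Fintype.card {s : Fin t // (h s).1 p = i}

/-- A multi-player bandit learning algorithm with horizon `T`: for each round, a conditional
probability distribution of the arms pulled by all the players, given the history of the previous
rounds. (Rounds are numbered `0, …, T - 1`, so `t` rounds precede round `t`.) -/
structure Algorithm (M K T : ℕ) where
  policy : (t : ℕ) → t < T → Kernel (History M K t) (Fin M → Fin K)
  isMarkovKernel_policy : ∀ t ht, IsMarkovKernel (policy t ht)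

attribute [instance] Algorithm.isMarkovKernel_policy

namespace Algorithm

variable {M K T : ℕ} (A : Algorithm M K T) (E : ProblemInstance M K)

/-- The conditional law of round `t` given the history: the arms are drawn from the policy, and
then the rewards from the reward distributions of the pulled arms. -/
def roundKernel (t : ℕ) (ht : t < T) : Kernel (History M K t) (Round M K) :=
  (A.policy t ht).compProd (Kernel.prodMkLeft (History M K t) E.rewardKernel)

instance (t : ℕ) (ht : t < T) : IsMarkovKernel (A.roundKernel E t ht) := by
  unfold roundKernel; infer_instance

/-- The law of the history of the first `t` rounds when `A` interacts with `E`. -/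
def historyLaw : (t : ℕ) → t ≤ T → Measure (History M K t)
  | 0, _ => Measure.dirac Fin.elim0
  | t + 1, ht =>
    ((historyLaw t (Nat.le_of_succ_le ht)).compProd (A.roundKernel E t ht)).map
      fun x : History M K t × Round M K => (Fin.snoc x.1 x.2 : History M K (t + 1))

/-- The expected collective regret `∑_p ∑_i Δ_i^p 𝔼[n_i^p(T)]` of `A` on `E`. -/
def expectedRegret : ℝ :=
  ∑ p : Fin M, ∑ i : Fin K,
    E.gap i p * ∫ h : History M K T, (pulls i p h : ℝ) ∂(A.historyLaw E T le_rfl)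

end Algorithm

/-- Appending a round to a history is measurable. -/
theorem measurable_snoc (M K t : ℕ) :
    Measurable fun x : History M K t × Round M K =>
      (Fin.snoc x.1 x.2 : History M K (t + 1)) := by
  refine measurable_pi_lambda _ fun s => ?_
  induction s using Fin.lastCases with
  | last => simpa using measurable_snd
  | cast s =>
    simpa [Function.comp_def] using (measurable_pi_apply s).comp
      (measurable_fst : Measurable (Prod.fst : History M K t × Round M K → _))

theorem Algorithm.isProbabilityMeasure_historyLaw {M K T : ℕ} (A : Algorithm M K T)
    (E : ProblemInstance M K) (t : ℕ) (ht : t ≤ T) :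
    IsProbabilityMeasure (A.historyLaw E t ht) := by
  induction t with
  | zero => unfold historyLaw; infer_instance
  | succ t ih =>
    have := ih (Nat.le_of_succ_le ht)
    unfold historyLaw
    exact Measure.isProbabilityMeasure_map (measurable_snoc M K t).aemeasurable

end MPMAB

end

noncomputable section

namespace MPMAB

/-! A change-of-measure argument. Take an arm `i` and a set `S` of players whose gaps on `i` are at
least `D`, with equality for some `q ∈ S`, and raise the mean of `i` by `2D` for every player in
`S`. In the new instance `i` is the best arm of `q` by a margin of at least `D`. If the new instance
is still an `ε`-instance, small regret forces `q` to pull `i` rarely in the old instance and almost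
always in the new one.

Telling the two instances apart costs samples. The policy cancels in the likelihood ratio of the
histories, whose expected logarithm is at least `-12 D² N`, where `N` is the expected number of
pulls of `i` by `S` (`Algorithm.le_integral_log_modifyRatio`); here `12 D² = 3 (2D)²` comes from the
quadratic bound `bernoulli_kl_le`. With `bretagnolle_huber` this gives `N ≥ log (D T^α / (8C)) / (12
D²)`, which is `Algorithm.le_sum_pulls`.

The two sums in the theorem are two choices of `S`. On an arm outside the subpar set all gaps are at
most `ε/4`, so raising a single player's mean by at most `ε/2` turns an `ε/2`-instance into an
`ε`-instance: `S = {p}` works, and each player pays separately. On a subpar arm all players are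
raised together by twice the minimal gap, which leaves the differences on that arm unchanged; only
the total number of pulls is then bounded, at the price of the minimal gap. -/

/-! ### Testing inequality, product densities, Bernoulli divergence -/

/-- Pointwise form of the Bretagnolle–Huber inequality. -/
theorem bretagnolle_huber_pointwise {x s y : ℝ} (hx : 0 < x) (hs : 0 < s)
    (hy₀ : 0 ≤ y) (hy₁ : y ≤ 1) :
    2 * s * (1 + Real.log x / 2 - Real.log s) ≤
      2 / s * (y + x * (1 - y)) + s / 2 * (1 + x) := by
  -- The tangent-line bound `1 + u ≤ exp u` at `u = log (√x / s)`.
  have hexp : s * (1 + Real.log x / 2 - Real.log s) ≤ Real.sqrt x := by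
    have h1 := Real.add_one_le_exp (Real.log x / 2 - Real.log s)
    have h2 : Real.exp (Real.log x / 2 - Real.log s) = Real.sqrt x / s := by
      rw [Real.exp_sub, Real.exp_log hs, Real.sqrt_eq_rpow, Real.rpow_def_of_pos hx]
      ring_nf
    rw [h2] at h1
    calc s * (1 + Real.log x / 2 - Real.log s) ≤ s * (Real.sqrt x / s) := by
          gcongr; linarith
      _ = Real.sqrt x := by field_simp
  set q := Real.sqrt x
  have hq : 0 < q := Real.sqrt_pos.2 hx
  have hqq : q * q = x := Real.mul_self_sqrt hx.le
  have key : 2 * q ≤ 2 / s * (y + x * (1 - y)) + s / 2 * (1 + x) := by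
    -- The convex combination is at least `min 1 x`, while `1 + x ≥ max 1 x`, and `min 1 x * max 1 x
    -- = x`.
    have hy2 : (y + x * (1 - y)) * (1 + x) ≥ x := by
      nlinarith [mul_nonneg hx.le hy₀, mul_nonneg hx.le (sub_nonneg.2 hy₁),
        mul_nonneg (mul_nonneg hx.le hx.le) (sub_nonneg.2 hy₁)]
    have hz : 0 < y + x * (1 - y) := by
      by_contra h
      nlinarith
    set z := y + x * (1 - y)
    -- AM-GM for the two summands on the right, whose product is `z * (1 + x)`.
    refine le_of_sq_le_sq ?_ (by positivity)
    have h4 : (2 * q) ^ 2 ≤ 4 * (z * (1 + x)) := by nlinarith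
    refine h4.trans ?_
    have h5 : 2 / s * z * (s / 2 * (1 + x)) = z * (1 + x) := by field_simp
    nlinarith [sq_nonneg (2 / s * z - s / 2 * (1 + x))]
  linarith

/-- The **Bretagnolle–Huber inequality** for a measure with an explicit positive density. -/
theorem bretagnolle_huber {Ω : Type*} [MeasurableSpace Ω] {μ ν : Measure Ω}
    [IsProbabilityMeasure μ] [IsProbabilityMeasure ν] {L f : Ω → ℝ} (hL : Measurable L)
    (hL₀ : ∀ ω, 0 < L ω) (hν : ν = μ.withDensity fun ω => ENNReal.ofReal (L ω))
    (hlog : Integrable (fun ω => Real.log (L ω)) μ) (hf : Measurable f)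
    (hf₀ : ∀ ω, 0 ≤ f ω) (hf₁ : ∀ ω, f ω ≤ 1) :
    Real.exp (∫ ω, Real.log (L ω) ∂μ) / 2 ≤ ∫ ω, f ω ∂μ + ∫ ω, (1 - f ω) ∂ν := by
  have hchange : ∀ g : Ω → ℝ, ∫ ω, g ω ∂ν = ∫ ω, L ω * g ω ∂μ := fun g => by
    rw [hν, integral_withDensity_eq_integral_toReal_smul hL.ennreal_ofReal (by simp)]
    simp [ENNReal.toReal_ofReal (hL₀ _).le]
  have hLone : ∫⁻ ω, ENNReal.ofReal (L ω) ∂μ = 1 := by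
    have h := measure_univ (μ := ν)
    rwa [hν, withDensity_apply _ MeasurableSet.univ, Measure.restrict_univ] at h
  have hLint : Integrable L μ := by
    refine ⟨hL.aestronglyMeasurable, ?_⟩
    rw [hasFiniteIntegral_iff_ofReal (.of_forall fun ω => (hL₀ ω).le), hLone]
    exact ENNReal.one_lt_top
  have hLint₁ : ∫ ω, L ω ∂μ = 1 := by
    have := hchange fun _ => 1
    simpa using this.symm
  have hfint : Integrable f μ :=
    Integrable.of_bound hf.aestronglyMeasurable 1
      (.of_forall fun ω => by rw [Real.norm_of_nonneg (hf₀ ω)]; exact hf₁ ω)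
  have hLf : Integrable (fun ω => L ω * (1 - f ω)) μ := by
    refine hLint.mul_bdd (c := 1) (by fun_prop) (.of_forall fun ω => ?_)
    rw [Real.norm_of_nonneg (by linarith [hf₁ ω])]
    linarith [hf₀ ω]
  rw [hchange]
  set ℓ := ∫ ω, Real.log (L ω) ∂μ
  -- With this choice the left side of the pointwise inequality integrates to `2 * s`, and the term
  -- `s / 2 * (1 + L)` to `s`. What remains is `s ^ 2 ≤ 2 * (...)`, where `s ^ 2 = exp ℓ`. The
  -- pointwise bound is linear in `log L`, `f` and `L`, so neither Jensen nor Cauchy–Schwarz is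
  -- needed.
  set s := Real.exp (ℓ / 2)
  have hs : 0 < s := Real.exp_pos _
  have hlogs : Real.log s = ℓ / 2 := Real.log_exp _
  have hlhs : Integrable (fun ω => 1 + Real.log (L ω) / 2) μ :=
    (integrable_const _).add (hlog.div_const 2)
  have hrhs : Integrable (fun ω => f ω + L ω * (1 - f ω)) μ := hfint.add hLf
  have hL' : Integrable (fun ω => 1 + L ω) μ := (integrable_const _).add hLint
  have hint := integral_mono (μ := μ)
    (f := fun ω => 2 * s * (1 + Real.log (L ω) / 2 - Real.log s))
    (g := fun ω => 2 / s * (f ω + L ω * (1 - f ω)) + s / 2 * (1 + L ω))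
    ((hlhs.sub (integrable_const _)).const_mul _)
    ((hrhs.const_mul _).add (hL'.const_mul _))
    (fun ω => bretagnolle_huber_pointwise (hL₀ ω) hs (hf₀ ω) (hf₁ ω))
  rw [integral_const_mul, integral_sub hlhs (integrable_const _),
    integral_add (integrable_const _) (hlog.div_const 2), integral_div,
    integral_add (hrhs.const_mul _) (hL'.const_mul _), integral_const_mul, integral_const_mul,
    integral_add hfint hLf, integral_add (integrable_const _) hLint, hLint₁, hlogs] at hint
  simp only [integral_const, probReal_univ, smul_eq_mul] at hint
  have hss : Real.exp ℓ = s * s := by rw [← Real.exp_add]; ring_nf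
  rw [hss]
  have h1 : s ≤ 2 / s * (∫ ω, f ω ∂μ + ∫ ω, L ω * (1 - f ω) ∂μ) := by linarith
  have h2 := mul_le_mul_of_nonneg_left h1 hs.le
  have h3 : s * (2 / s * (∫ ω, f ω ∂μ + ∫ ω, L ω * (1 - f ω) ∂μ))
      = 2 * (∫ ω, f ω ∂μ + ∫ ω, L ω * (1 - f ω) ∂μ) := by field_simp
  linarith

/-- A product of densities is a density of the product measure. -/
theorem pi_withDensity {ι : Type*} [Fintype ι] {X : ι → Type*} [∀ i, MeasurableSpace (X i)]
    (μ ν : ∀ i, Measure (X i)) [∀ i, IsProbabilityMeasure (μ i)]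
    [∀ i, IsProbabilityMeasure (ν i)] (w : ∀ i, X i → ENNReal) (hw : ∀ i, Measurable (w i))
    (h : ∀ i, ν i = (μ i).withDensity (w i)) :
    Measure.pi ν = (Measure.pi μ).withDensity fun x => ∏ i, w i (x i) := by
  refine (Measure.pi_eq fun s hs => ?_)
  have hind : iIndepFun (fun i (x : ∀ i, X i) => (s i).indicator (w i) (x i)) (Measure.pi μ) :=
    iIndepFun_pi fun i => ((hw i).indicator (hs i)).aemeasurable
  rw [withDensity_apply _ (MeasurableSet.univ_pi hs),
    ← lintegral_indicator (MeasurableSet.univ_pi hs)]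
  calc _ = ∫⁻ x, ∏ i, (s i).indicator (w i) (x i) ∂(Measure.pi μ) := by
        refine lintegral_congr fun x => ?_
        classical
        by_cases hx : x ∈ Set.univ.pi s
        · rw [Set.indicator_of_mem hx]
          exact Finset.prod_congr rfl fun i _ => (Set.indicator_of_mem (hx i trivial) _).symm
        · rw [Set.indicator_of_notMem hx]
          obtain ⟨i, hi⟩ : ∃ i, x i ∉ s i := by simpa [Set.mem_pi] using hx
          exact (Finset.prod_eq_zero (Finset.mem_univ i) (Set.indicator_of_notMem hi _)).symm
    _ = ∏ i, ∫⁻ x, (s i).indicator (w i) (x i) ∂(Measure.pi μ) := by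
        have := lintegral_prod_eq_prod_lintegral_of_indepFun Finset.univ _ hind
          (fun i => ((hw i).indicator (hs i)).comp (measurable_pi_apply i))
        simpa using this
    _ = ∏ i, ν i (s i) := by
        refine Finset.prod_congr rfl fun i _ => ?_
        rw [(measurePreserving_eval μ i).lintegral_comp ((hw i).indicator (hs i)),
          lintegral_indicator (hs i), h i, withDensity_apply _ (hs i)]

/-- A quadratic upper bound on the Kullback–Leibler divergence of two Bernoulli distributions. -/
theorem bernoulli_kl_le {a b : ℝ} (ha : 15 / 32 ≤ a) (hab : a ≤ b) (hb : b ≤ 19 / 32) :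
    -(3 * (b - a) ^ 2) ≤ a * Real.log (b / a) + (1 - a) * Real.log ((1 - b) / (1 - a)) := by
  have hderiv : ∀ x ∈ Set.Icc a b, HasDerivAt
      (fun x => a * Real.log x + (1 - a) * Real.log (1 - x) + 3 * (x - a) ^ 2)
      (a * x⁻¹ + (1 - a) * (-1 / (1 - x)) + 3 * (2 * (x - a))) x := by
    rintro x ⟨hx₁, hx₂⟩
    have h1 := (Real.hasDerivAt_log (x := x) (by linarith)).const_mul a
    have h2 := (((hasDerivAt_id x).const_sub 1).log (by simp; linarith)).const_mul (1 - a)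
    have h3 := (((hasDerivAt_id x).sub_const a).pow 2).const_mul 3
    refine ((h1.add h2).add h3).congr_deriv ?_
    simp
  have hmono : MonotoneOn
      (fun x => a * Real.log x + (1 - a) * Real.log (1 - x) + 3 * (x - a) ^ 2)
      (Set.Icc a b) := by
    refine monotoneOn_of_deriv_nonneg (convex_Icc a b)
      (fun x hx => (hderiv x hx).continuousAt.continuousWithinAt)
      (fun x hx => (hderiv x (interior_subset hx)).differentiableAt.differentiableWithinAt)
      fun x hx => ?_
    have hx' := interior_subset hx
    rw [(hderiv x hx').deriv]
    obtain ⟨hx₁, hx₂⟩ := hx'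
    have hx0 : 0 < x := by linarith
    have hx1 : 0 < 1 - x := by linarith
    have : a * x⁻¹ + (1 - a) * (-1 / (1 - x)) + 3 * (2 * (x - a))
        = (x - a) * (6 * (x * (1 - x)) - 1) / (x * (1 - x)) := by
      field_simp
      ring
    rw [this]
    refine div_nonneg (mul_nonneg (by linarith) ?_) (by positivity)
    -- On `[15/32, 19/32]` the variance `x * (1 - x)` is at least `247/1024`, hence more than the
    -- required `1/6`.
    nlinarith [mul_nonneg (sub_nonneg.2 (ha.trans hx₁)) (sub_nonneg.2 (hx₂.trans hb))]
  have h := hmono (Set.left_mem_Icc.2 hab) (Set.right_mem_Icc.2 hab) hab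
  rw [Real.log_div (by linarith) (by linarith), Real.log_div (by linarith) (by linarith)]
  simp only [sub_self] at h
  linarith

/-! ### Likelihood ratios of histories -/

variable {M K T : ℕ}

namespace ProblemInstance

/-- `w` is a family of densities of the reward distributions of `E'` with respect to those
of `E`. -/
structure IsDensity (E E' : ProblemInstance M K) (w : Fin K → Fin M → ℝ → ℝ) : Prop where
  measurable : ∀ i p, Measurable (w i p)
  pos : ∀ i p x, 0 < w i p x
  dist_eq : ∀ i p, E'.dist i p = (E.dist i p).withDensity fun x => ENNReal.ofReal (w i p x)

end ProblemInstance

/-- The likelihood ratio of one round. -/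
def roundRatio (w : Fin K → Fin M → ℝ → ℝ) (y : Round M K) : ℝ := ∏ p, w (y.1 p) p (y.2 p)

theorem measurable_roundRatio {w : Fin K → Fin M → ℝ → ℝ} (hw : ∀ i p, Measurable (w i p)) :
    Measurable (roundRatio w) :=
  measurable_from_prod_countable_right fun a =>
    Finset.measurable_prod _ fun p _ => (hw (a p) p).comp (measurable_pi_apply p)

namespace ProblemInstance.IsDensity

variable {E E' : ProblemInstance M K} {w : Fin K → Fin M → ℝ → ℝ}

theorem roundRatio_pos (h : E.IsDensity E' w) (y : Round M K) : 0 < roundRatio w y :=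
  Finset.prod_pos fun _ _ => h.pos _ _ _

/-- The arms are drawn from the same policy under both instances, so only the reward laws of the
pulled arms contribute to the density. -/
theorem lintegral_roundKernel (h : E.IsDensity E' w) (A : Algorithm M K T) {t : ℕ} (ht : t < T)
    (x : History M K t) {f : Round M K → ENNReal} (hf : Measurable f) :
    ∫⁻ y, f y ∂(A.roundKernel E' t ht x) =
      ∫⁻ y, ENNReal.ofReal (roundRatio w y) * f y ∂(A.roundKernel E t ht x) := by
  have hw := (measurable_roundRatio h.measurable).ennreal_ofReal
  have hwf : Measurable fun y => ENNReal.ofReal (roundRatio w y) * f y := hw.mul hf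
  rw [Algorithm.roundKernel, Algorithm.roundKernel, Kernel.lintegral_compProd _ _ _ hf,
    Kernel.lintegral_compProd _ _ _ hwf]
  refine lintegral_congr fun a => ?_
  rw [Kernel.prodMkLeft_apply, Kernel.prodMkLeft_apply]
  change ∫⁻ r, f (a, r) ∂(Measure.pi fun p => E'.dist (a p) p) =
    ∫⁻ r, _ ∂(Measure.pi fun p => E.dist (a p) p)
  have hwa : Measurable fun r : Fin M → ℝ => ∏ p, ENNReal.ofReal (w (a p) p (r p)) :=
    Finset.measurable_prod _ fun p _ =>
      ((h.measurable _ _).ennreal_ofReal).comp (measurable_pi_apply p)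
  have hfa : Measurable fun r => f (a, r) := hf.comp measurable_prodMk_left
  rw [pi_withDensity (fun p => E.dist (a p) p) (fun p => E'.dist (a p) p)
    (fun p x => ENNReal.ofReal (w (a p) p x)) (fun p => (h.measurable _ _).ennreal_ofReal)
    (fun p => h.dist_eq _ _), lintegral_withDensity_eq_lintegral_mul _ hwa hfa]
  refine lintegral_congr fun r => ?_
  simp only [Pi.mul_apply, roundRatio]
  rw [ENNReal.ofReal_prod_of_nonneg fun p _ => (h.pos _ _ _).le]

theorem lintegral_historyLaw (h : E.IsDensity E' w) (A : Algorithm M K T) (t : ℕ) (ht : t ≤ T)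
    {f : History M K t → ENNReal} (hf : Measurable f) :
    ∫⁻ x, f x ∂(A.historyLaw E' t ht) =
      ∫⁻ x, ENNReal.ofReal (∏ s, roundRatio w (x s)) * f x ∂(A.historyLaw E t ht) := by
  have hw := measurable_roundRatio h.measurable
  have hprod (t : ℕ) : Measurable fun x : History M K t =>
      ENNReal.ofReal (∏ s, roundRatio w (x s)) :=
    (Finset.measurable_prod _ fun s _ => hw.comp (measurable_pi_apply s)).ennreal_ofReal
  induction t with
  | zero => simp [Algorithm.historyLaw]
  | succ t ih =>
    have hs := measurable_snoc M K t
    have := A.isProbabilityMeasure_historyLaw E t (Nat.le_of_succ_le ht)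
    have := A.isProbabilityMeasure_historyLaw E' t (Nat.le_of_succ_le ht)
    have hpf : Measurable fun x : History M K (t + 1) =>
        ENNReal.ofReal (∏ s, roundRatio w (x s)) * f x := (hprod _).mul hf
    have hfs : Measurable fun x : History M K t × Round M K => f (Fin.snoc x.1 x.2) := hf.comp hs
    have hpfs : Measurable fun x : History M K t × Round M K =>
        ENNReal.ofReal (∏ s, roundRatio w ((Fin.snoc x.1 x.2 : History M K (t + 1)) s)) *
          f (Fin.snoc x.1 x.2) := hpf.comp hs
    rw [Algorithm.historyLaw, Algorithm.historyLaw, lintegral_map hf hs,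
      lintegral_map hpf hs, Measure.lintegral_compProd hfs,
      Measure.lintegral_compProd hpfs,
      ih _ (Measurable.lintegral_kernel_prod_right' hfs)]
    refine lintegral_congr fun x => ?_
    have hwf : Measurable fun y => ENNReal.ofReal (roundRatio w y) * f (Fin.snoc x y) :=
      hw.ennreal_ofReal.mul (hfs.comp measurable_prodMk_left)
    rw [h.lintegral_roundKernel A ht x (f := fun y => f (Fin.snoc x y))
      (hfs.comp measurable_prodMk_left), ← lintegral_const_mul _ hwf]
    refine lintegral_congr fun y => ?_
    simp only [Fin.prod_univ_castSucc, Fin.snoc_castSucc, Fin.snoc_last]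
    rw [ENNReal.ofReal_mul (Finset.prod_nonneg fun s _ => (h.roundRatio_pos _).le), mul_assoc]

theorem historyLaw_eq_withDensity (h : E.IsDensity E' w) (A : Algorithm M K T) (t : ℕ)
    (ht : t ≤ T) :
    A.historyLaw E' t ht =
      (A.historyLaw E t ht).withDensity fun x => ENNReal.ofReal (∏ s, roundRatio w (x s)) := by
  have hw := measurable_roundRatio h.measurable
  have hprod : Measurable fun x : History M K t => ENNReal.ofReal (∏ s, roundRatio w (x s)) :=
    (Finset.measurable_prod _ fun s _ => hw.comp (measurable_pi_apply s)).ennreal_ofReal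
  ext S hS
  rw [withDensity_apply _ hS, ← lintegral_indicator_one hS,
    h.lintegral_historyLaw A t ht (measurable_one.indicator hS), ← lintegral_indicator hS]
  refine lintegral_congr fun x => ?_
  by_cases hx : x ∈ S <;> simp [hx]

end ProblemInstance.IsDensity

/-! ### Sums over rounds and pull counts -/

/-- If the conditional expectation of `u` in each round, given the arms, is nonnegative, then so is
the expectation of the sum of `u` over the rounds. -/
theorem Algorithm.integral_sum_historyLaw_nonneg (A : Algorithm M K T)
    (E : ProblemInstance M K) {u : Round M K → ℝ} (hu : Measurable u) {B : ℝ}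
    (hB : ∀ y, |u y| ≤ B)
    (hnonneg : ∀ a : Fin M → Fin K, 0 ≤ ∫ r, u (a, r) ∂(Measure.pi fun p => E.dist (a p) p))
    (t : ℕ) (ht : t ≤ T) :
    0 ≤ ∫ x, ∑ s, u (x s) ∂(A.historyLaw E t ht) := by
  have hsum (t : ℕ) : Measurable fun x : History M K t => ∑ s, u (x s) :=
    Finset.measurable_sum _ fun s _ => hu.comp (measurable_pi_apply s)
  have hsumB (t : ℕ) (x : History M K t) : ‖∑ s, u (x s)‖ ≤ t * B :=
    (norm_sum_le_of_le _ fun s _ => hB (x s)).trans (by simp)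
  induction t with
  | zero => simp
  | succ t ih =>
    have hs := measurable_snoc M K t
    have hP := A.isProbabilityMeasure_historyLaw E t (Nat.le_of_succ_le ht)
    have hint₁ : Integrable (fun x : History M K t × Round M K => ∑ s, u (x.1 s))
        ((A.historyLaw E t (Nat.le_of_succ_le ht)).compProd (A.roundKernel E t ht)) :=
      .of_bound ((hsum t).comp measurable_fst).aestronglyMeasurable (t * B)
        (.of_forall fun x => hsumB t x.1)
    have hint₂ : Integrable (fun x : History M K t × Round M K => u x.2)
        ((A.historyLaw E t (Nat.le_of_succ_le ht)).compProd (A.roundKernel E t ht)) :=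
      .of_bound (hu.comp measurable_snd).aestronglyMeasurable B (.of_forall fun x => hB x.2)
    rw [historyLaw, integral_map hs.aemeasurable (hsum _).aestronglyMeasurable]
    simp only [Fin.sum_univ_castSucc, Fin.snoc_castSucc, Fin.snoc_last]
    rw [integral_add hint₁ hint₂, Measure.integral_compProd hint₁,
      Measure.integral_compProd hint₂]
    simp only [integral_const, probReal_univ, one_smul]
    refine add_nonneg (ih _) (integral_nonneg fun x => ?_)
    have hint₃ : Integrable u (A.roundKernel E t ht x) :=
      .of_bound hu.aestronglyMeasurable B (.of_forall hB)
    change 0 ≤ ∫ y, u y ∂(A.roundKernel E t ht x)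
    rw [roundKernel] at hint₃ ⊢
    rw [ProbabilityTheory.integral_compProd hint₃]
    refine integral_nonneg fun a => ?_
    rw [Kernel.prodMkLeft_apply]
    exact hnonneg a

theorem pulls_eq_sum {t : ℕ} (i : Fin K) (p : Fin M) (x : History M K t) :
    (pulls i p x : ℝ) = ∑ s, if (x s).1 p = i then (1 : ℝ) else 0 := by
  rw [pulls, Fintype.card_subtype, Finset.sum_boole]

theorem measurable_pulls {t : ℕ} (i : Fin K) (p : Fin M) :
    Measurable fun x : History M K t => (pulls i p x : ℝ) := by
  simp only [pulls_eq_sum]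
  refine Finset.measurable_sum _ fun s _ => ?_
  have : Measurable fun a : Fin M → Fin K => if a p = i then (1 : ℝ) else 0 :=
    measurable_of_countable _
  exact this.comp (measurable_fst.comp (measurable_pi_apply s))

theorem pulls_le {t : ℕ} (i : Fin K) (p : Fin M) (x : History M K t) :
    (pulls i p x : ℝ) ≤ t := by
  rw [pulls_eq_sum]
  calc _ ≤ ∑ _s : Fin t, (1 : ℝ) := Finset.sum_le_sum fun s _ => by split_ifs <;> norm_num
    _ = t := by simp

theorem sum_pulls {t : ℕ} (p : Fin M) (x : History M K t) :
    ∑ i, (pulls i p x : ℝ) = t := by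
  simp only [pulls_eq_sum]
  rw [Finset.sum_comm]
  simp

theorem Algorithm.integrable_pulls (A : Algorithm M K T) (E : ProblemInstance M K)
    (i : Fin K) (p : Fin M) :
    Integrable (fun x : History M K T => (pulls i p x : ℝ)) (A.historyLaw E T le_rfl) := by
  have := A.isProbabilityMeasure_historyLaw E T le_rfl
  refine .of_bound (measurable_pulls i p).aestronglyMeasurable T (.of_forall fun x => ?_)
  rw [Real.norm_of_nonneg (Nat.cast_nonneg _)]
  exact pulls_le i p x

/-! ### Bernoulli laws and their likelihood ratios -/

theorem bernoulliMeasure_eq (θ : unitInterval) :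
    bernoulliMeasure (1 : ℝ) 0 θ = ENNReal.ofReal θ • Measure.dirac (1 : ℝ) +
      ENNReal.ofReal (1 - θ) • Measure.dirac (0 : ℝ) := by
  have h (x : unitInterval) : ENNReal.ofReal x = (unitInterval.toNNReal x : ENNReal) := by
    rw [ENNReal.ofReal, ENNReal.coe_inj]
    exact Real.toNNReal_of_nonneg x.2.1
  have h₂ := h (unitInterval.symm θ)
  rw [unitInterval.coe_symm_eq] at h₂
  rw [bernoulliMeasure_def, h, h₂]
  rfl

theorem integral_bernoulli (θ : unitInterval) (f : ℝ → ℝ) :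
    ∫ x, f x ∂(bernoulliMeasure (1 : ℝ) 0 θ) = θ * f 1 + (1 - θ) * f 0 := by
  have hi (c x : ℝ) : Integrable f (ENNReal.ofReal c • Measure.dirac x) :=
    (integrable_dirac (by simp)).smul_measure ENNReal.ofReal_ne_top
  rw [bernoulliMeasure_eq, integral_add_measure (hi _ _) (hi _ _), integral_smul_measure,
    integral_smul_measure, integral_dirac, integral_dirac, ENNReal.toReal_ofReal θ.2.1,
    ENNReal.toReal_ofReal (sub_nonneg.2 θ.2.2), smul_eq_mul, smul_eq_mul]

/-- The likelihood ratio of the Bernoulli distributions with means `b` and `a`. -/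
def bernoulliRatio (a b x : ℝ) : ℝ := if x = 1 then b / a else (1 - b) / (1 - a)

theorem measurable_bernoulliRatio (a b : ℝ) : Measurable (bernoulliRatio a b) :=
  Measurable.ite (measurableSet_singleton 1) measurable_const measurable_const

theorem bernoulliMeasure_eq_withDensity {a b : unitInterval} (ha₀ : 0 < (a : ℝ))
    (ha₁ : (a : ℝ) < 1) :
    bernoulliMeasure (1 : ℝ) 0 b = (bernoulliMeasure (1 : ℝ) 0 a).withDensity
      fun x => ENNReal.ofReal (bernoulliRatio a b x) := by
  have hm := (measurable_bernoulliRatio a b).ennreal_ofReal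
  ext s hs
  rw [withDensity_apply _ hs, ← lintegral_indicator hs, bernoulliMeasure_eq a,
    lintegral_add_measure, lintegral_smul_measure, lintegral_smul_measure,
    lintegral_dirac' _ (hm.indicator hs), lintegral_dirac' _ (hm.indicator hs),
    bernoulliMeasure_eq b]
  have h₁ : ENNReal.ofReal b = ENNReal.ofReal a * ENNReal.ofReal (bernoulliRatio a b 1) := by
    rw [← ENNReal.ofReal_mul ha₀.le, bernoulliRatio, if_pos rfl, mul_div_cancel₀ _ ha₀.ne']
  have h₀ : ENNReal.ofReal (1 - b) =
      ENNReal.ofReal (1 - a) * ENNReal.ofReal (bernoulliRatio a b 0) := by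
    rw [← ENNReal.ofReal_mul (sub_nonneg.2 ha₁.le), bernoulliRatio, if_neg (by norm_num),
      mul_div_cancel₀ _ (sub_pos.2 ha₁).ne']
  rw [h₁, h₀]
  by_cases h1 : (1 : ℝ) ∈ s <;> by_cases h0 : (0 : ℝ) ∈ s <;> simp [hs, h1, h0]

/-- The ratios lie between `13/17` and `19/15`. The cruder bounds keep all log-likelihoods bounded,
which settles every integrability question about them. -/
theorem bernoulliRatio_bounds {a b : ℝ} (ha : 15 / 32 ≤ a) (ha' : a ≤ 17 / 32) (hab : a ≤ b)
    (hb : b ≤ 19 / 32) (x : ℝ) :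
    1 / 2 ≤ bernoulliRatio a b x ∧ bernoulliRatio a b x ≤ 2 := by
  unfold bernoulliRatio
  split_ifs
  · constructor
    · rw [le_div_iff₀ (by linarith)]; linarith
    · rw [div_le_iff₀ (by linarith)]; linarith
  · constructor
    · rw [le_div_iff₀ (by linarith)]; linarith
    · rw [div_le_iff₀ (by linarith)]; linarith

theorem abs_log_le_one {x : ℝ} (h₁ : 1 / 2 ≤ x) (h₂ : x ≤ 2) : |Real.log x| ≤ 1 := by
  have hx : 0 < x := by linarith
  rw [abs_le]
  constructor
  · have := Real.one_sub_inv_le_log_of_pos hx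
    have : x⁻¹ ≤ 2 := by rw [inv_le_comm₀ hx two_pos]; linarith
    linarith
  · linarith [Real.log_le_sub_one_of_pos hx]

/-! ### Instances with one arm modified, and gaps -/

namespace ProblemInstance

/-- The instance obtained from `E` by replacing the reward distributions of arm `i` for the players
`p ∈ S` by Bernoulli distributions with means `b p`. -/
def modify (E : ProblemInstance M K) (i : Fin K) (S : Finset (Fin M)) (b : Fin M → unitInterval) :
    ProblemInstance M K where
  dist j p := if j = i ∧ p ∈ S then bernoulliMeasure 1 0 (b p) else E.dist j p
  isProbabilityMeasure_dist j p := by split_ifs <;> infer_instance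
  dist_compl_Icc j p := by
    split_ifs
    · exact bernoulliMeasure_apply_of_notMem_of_notMem _ measurableSet_Icc.compl (by simp)
        (by simp)
    · exact E.dist_compl_Icc j p

/-- The likelihood ratios of the rewards of `E.modify i S b` with respect to those of `E`. -/
def modifyRatio (E : ProblemInstance M K) (i : Fin K) (S : Finset (Fin M))
    (b : Fin M → unitInterval) (j : Fin K) (p : Fin M) (x : ℝ) : ℝ :=
  if j = i ∧ p ∈ S then bernoulliRatio (E.mean i p) (b p) x else 1

variable {E : ProblemInstance M K} {i : Fin K} {S : Finset (Fin M)} {b : Fin M → unitInterval}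

theorem IsBernoulli.exists_mean (hE : E.IsBernoulli) (j : Fin K) (p : Fin M) :
    ∃ θ : unitInterval, E.dist j p = bernoulliMeasure 1 0 θ ∧ E.mean j p = θ := by
  obtain ⟨θ, hθ⟩ := hE j p
  refine ⟨θ, hθ, ?_⟩
  rw [mean, hθ, integral_bernoulli]
  ring

theorem mean_modify (j : Fin K) (p : Fin M) :
    (E.modify i S b).mean j p = if j = i ∧ p ∈ S then (b p : ℝ) else E.mean j p := by
  unfold mean modify
  dsimp only
  split_ifs
  · rw [integral_bernoulli]; ring
  · rfl

theorem modifyRatio_bounds (hmean : ∀ i p, E.mean i p ∈ Set.Icc (15 / 32 : ℝ) (17 / 32))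
    (hb : ∀ p ∈ S, (b p : ℝ) ∈ Set.Icc (E.mean i p) (19 / 32)) (j : Fin K) (p : Fin M) (x : ℝ) :
    1 / 2 ≤ E.modifyRatio i S b j p x ∧ E.modifyRatio i S b j p x ≤ 2 := by
  unfold modifyRatio
  split_ifs with h
  · exact bernoulliRatio_bounds (hmean i p).1 (hmean i p).2 (hb p h.2).1 (hb p h.2).2 x
  · norm_num

theorem isDensity_modify (hE : E.IsBernoulli)
    (hmean : ∀ i p, E.mean i p ∈ Set.Icc (15 / 32 : ℝ) (17 / 32))
    (hb : ∀ p ∈ S, (b p : ℝ) ∈ Set.Icc (E.mean i p) (19 / 32)) :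
    E.IsDensity (E.modify i S b) (E.modifyRatio i S b) where
  measurable j p := by
    unfold modifyRatio
    split_ifs
    · exact measurable_bernoulliRatio _ _
    · exact measurable_const
  pos j p x := by linarith [(modifyRatio_bounds hmean hb j p x).1]
  dist_eq j p := by
    by_cases h : j = i ∧ p ∈ S
    · obtain ⟨θ, hθ, hθ'⟩ := hE.exists_mean j p
      have hm := hmean j p
      obtain ⟨rfl, hp⟩ := h
      simp only [modify, modifyRatio, hp, and_self, if_true]
      rw [hθ']
      rw [hθ'] at hm
      rw [hθ]
      exact bernoulliMeasure_eq_withDensity (by linarith [hm.1]) (by linarith [hm.2])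
    · simp [modify, modifyRatio, h]

/-- On a modified entry the expected log ratio is minus the Bernoulli divergence, which `c`
compensates; elsewhere the ratio is `1` and the integrand vanishes. -/
theorem le_integral_log_modifyRatio (hE : E.IsBernoulli)
    (hmean : ∀ i p, E.mean i p ∈ Set.Icc (15 / 32 : ℝ) (17 / 32))
    (hb : ∀ p ∈ S, (b p : ℝ) ∈ Set.Icc (E.mean i p) (19 / 32)) {c : ℝ}
    (hc : ∀ p ∈ S, 3 * (b p - E.mean i p) ^ 2 ≤ c) (j : Fin K) (p : Fin M) :
    0 ≤ ∫ x, (Real.log (E.modifyRatio i S b j p x) + if j = i ∧ p ∈ S then c else 0)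
      ∂(E.dist j p) := by
  by_cases h : j = i ∧ p ∈ S
  · obtain ⟨θ, hθ, hθ'⟩ := hE.exists_mean j p
    obtain ⟨rfl, hp⟩ := h
    have hkl := bernoulli_kl_le (hmean j p).1 (hb p hp).1 (hb p hp).2
    have hc := hc p hp
    simp only [modifyRatio, hp, and_self, if_true]
    rw [hθ, integral_bernoulli, bernoulliRatio, bernoulliRatio, if_pos rfl, if_neg (by norm_num)]
    rw [hθ'] at hkl hc ⊢
    linarith
  · simp [modifyRatio, h]

theorem bddAbove_mean (E : ProblemInstance M K) (p : Fin M) :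
    BddAbove (Set.range fun i => E.mean i p) := (Set.finite_range _).bddAbove

theorem mean_le_optMean (E : ProblemInstance M K) (i : Fin K) (p : Fin M) :
    E.mean i p ≤ E.optMean p := le_ciSup (E.bddAbove_mean p) i

theorem gap_nonneg (E : ProblemInstance M K) (i : Fin K) (p : Fin M) : 0 ≤ E.gap i p :=
  sub_nonneg.2 (E.mean_le_optMean i p)

end ProblemInstance

/-! ### Expected log-likelihood ratio against pulls -/

/-- The expected log-likelihood ratio of the histories under `E` and a modification of `E` is bounded
in terms of the expected number of pulls of the modified arm. -/
theorem Algorithm.le_integral_log_modifyRatio (A : Algorithm M K T) {E : ProblemInstance M K}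
    {i : Fin K} {S : Finset (Fin M)} {b : Fin M → unitInterval} (hE : E.IsBernoulli)
    (hmean : ∀ i p, E.mean i p ∈ Set.Icc (15 / 32 : ℝ) (17 / 32))
    (hb : ∀ p ∈ S, (b p : ℝ) ∈ Set.Icc (E.mean i p) (19 / 32)) {c : ℝ}
    (hc : ∀ p ∈ S, 3 * (b p - E.mean i p) ^ 2 ≤ c) :
    Integrable (fun x => Real.log (∏ s, roundRatio (E.modifyRatio i S b) (x s)))
      (A.historyLaw E T le_rfl) ∧
    -(c * ∑ p ∈ S, ∫ x, (pulls i p x : ℝ) ∂(A.historyLaw E T le_rfl)) ≤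
      ∫ x, Real.log (∏ s, roundRatio (E.modifyRatio i S b) (x s))
        ∂(A.historyLaw E T le_rfl) := by
  have hP := A.isProbabilityMeasure_historyLaw E T le_rfl
  have hdens := ProblemInstance.isDensity_modify hE hmean hb
  set w := E.modifyRatio i S b
  have hw := measurable_roundRatio hdens.measurable
  have hwB (j p x) : |Real.log (w j p x)| ≤ 1 := by
    have := ProblemInstance.modifyRatio_bounds hmean hb j p x
    exact abs_log_le_one this.1 this.2
  have hlogw (y : Round M K) : Real.log (roundRatio w y) = ∑ p, Real.log (w (y.1 p) p (y.2 p)) :=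
    Real.log_prod fun p _ => (hdens.pos _ _ _).ne'
  have hlogB (y : Round M K) : ‖Real.log (roundRatio w y)‖ ≤ M := by
    rw [hlogw]
    exact (norm_sum_le_of_le _ fun p _ => hwB _ _ _).trans (by simp)
  have hlogL (x : History M K T) : Real.log (∏ s, roundRatio w (x s)) =
      ∑ s, Real.log (roundRatio w (x s)) :=
    Real.log_prod fun s _ => (hdens.roundRatio_pos _).ne'
  have hint : Integrable (fun x => Real.log (∏ s, roundRatio w (x s)))
      (A.historyLaw E T le_rfl) := by
    refine .of_bound (Finset.measurable_prod _ fun s _ =>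
      hw.comp (measurable_pi_apply s)).log.aestronglyMeasurable (T * M) (.of_forall fun x => ?_)
    rw [hlogL]
    exact (norm_sum_le_of_le _ fun s _ => hlogB _).trans (by simp)
  refine ⟨hint, ?_⟩
  let v (a : Fin M → Fin K) (p : Fin M) : ℝ := if a p = i ∧ p ∈ S then c else 0
  have hvB (a p) : ‖v a p‖ ≤ |c| := by
    by_cases h : a p = i ∧ p ∈ S <;> simp [v, h]
  have hv : Measurable fun y : Round M K => ∑ p, v y.1 p :=
    (measurable_of_countable fun a => ∑ p, v a p).comp measurable_fst
  -- Each pull of a modified entry is credited with `c`. Given the arms, the compensated log ratio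
  -- of a round then has nonnegative mean, which replaces the chain rule for the divergence.
  have hnonneg := A.integral_sum_historyLaw_nonneg E
    (u := fun y => Real.log (roundRatio w y) + ∑ p, v y.1 p) (hw.log.add hv)
    (B := M + M * |c|) (fun y => (abs_add_le _ _).trans (add_le_add (hlogB y)
      ((norm_sum_le_of_le _ fun p _ => hvB y.1 p).trans (by simp))))
    (fun a => by
      have hmeas (p : Fin M) : Measurable fun x => Real.log (w (a p) p x) + v a p :=
        (hdens.measurable _ _).log.add_const _
      have hbdd (p : Fin M) (x : ℝ) : ‖Real.log (w (a p) p x) + v a p‖ ≤ 1 + |c| :=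
        (norm_add_le _ _).trans (add_le_add (hwB _ _ _) (hvB _ _))
      simp only [hlogw, ← Finset.sum_add_distrib]
      have hint_p (p : Fin M) : Integrable (fun r : Fin M → ℝ => Real.log (w (a p) p (r p)) + v a p)
          (Measure.pi fun p => E.dist (a p) p) :=
        .of_bound ((hmeas p).comp (measurable_pi_apply p)).aestronglyMeasurable (1 + |c|)
          (.of_forall fun r => hbdd p (r p))
      rw [integral_finsetSum _ fun p _ => hint_p p]
      refine Finset.sum_nonneg fun p _ => ?_
      rw [integral_comp_eval (μ := fun p => E.dist (a p) p)
        (f := fun x => Real.log (w (a p) p x) + v a p) (hmeas p).aestronglyMeasurable]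
      exact ProblemInstance.le_integral_log_modifyRatio hE hmean hb hc (a p) p) T le_rfl
  have hpulls (x : History M K T) : ∑ s, ∑ p, v (x s).1 p = ∑ p ∈ S, c * (pulls i p x : ℝ) := by
    rw [Finset.sum_comm, ← Finset.sum_subset (Finset.subset_univ S)
      (fun p _ hp => Finset.sum_eq_zero fun s _ => by simp [v, hp])]
    refine Finset.sum_congr rfl fun p hp => ?_
    rw [pulls_eq_sum, Finset.mul_sum]
    exact Finset.sum_congr rfl fun s _ => by simp [v, hp]
  have hpint (p : Fin M) (_ : p ∈ S) := (A.integrable_pulls E i p).const_mul c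
  simp only [Finset.sum_add_distrib, ← hlogL, hpulls] at hnonneg
  rw [integral_add hint (integrable_finsetSum _ hpint), integral_finsetSum _ hpint] at hnonneg
  simp only [integral_const_mul, ← Finset.mul_sum] at hnonneg
  linarith

/-! ### From regret to pulls -/

theorem Algorithm.integral_pulls_nonneg (A : Algorithm M K T) (E : ProblemInstance M K)
    (i : Fin K) (p : Fin M) : 0 ≤ ∫ x, (pulls i p x : ℝ) ∂(A.historyLaw E T le_rfl) :=
  integral_nonneg fun _ => Nat.cast_nonneg _

theorem Algorithm.sum_gap_mul_pulls_le (A : Algorithm M K T) (E : ProblemInstance M K)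
    (p : Fin M) :
    ∑ i, E.gap i p * ∫ x, (pulls i p x : ℝ) ∂(A.historyLaw E T le_rfl) ≤ A.expectedRegret E :=
  Finset.single_le_sum
    (f := fun p => ∑ i, E.gap i p * ∫ x, (pulls i p x : ℝ) ∂(A.historyLaw E T le_rfl))
    (fun q _ => Finset.sum_nonneg fun i _ =>
      mul_nonneg (E.gap_nonneg i q) (A.integral_pulls_nonneg E i q)) (Finset.mem_univ p)

theorem Algorithm.gap_mul_pulls_le (A : Algorithm M K T) (E : ProblemInstance M K)
    (i : Fin K) (p : Fin M) :
    E.gap i p * ∫ x, (pulls i p x : ℝ) ∂(A.historyLaw E T le_rfl) ≤ A.expectedRegret E :=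
  (Finset.single_le_sum
    (f := fun i => E.gap i p * ∫ x, (pulls i p x : ℝ) ∂(A.historyLaw E T le_rfl))
    (fun i _ => mul_nonneg (E.gap_nonneg i p) (A.integral_pulls_nonneg E i p))
    (Finset.mem_univ i)).trans (A.sum_gap_mul_pulls_le E p)

/-- If arm `i` is the best one for player `p` by a margin of `D`, then the regret is at least `D`
times the expected number of rounds in which `p` does not pull `i`. -/
theorem Algorithm.mul_sub_pulls_le (A : Algorithm M K T) (E : ProblemInstance M K)
    (i : Fin K) (p : Fin M) {D : ℝ} (hD : ∀ j, j ≠ i → D ≤ E.gap j p) :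
    D * (T - ∫ x, (pulls i p x : ℝ) ∂(A.historyLaw E T le_rfl)) ≤ A.expectedRegret E := by
  have hP := A.isProbabilityMeasure_historyLaw E T le_rfl
  have hsum : ∑ j, ∫ x, (pulls j p x : ℝ) ∂(A.historyLaw E T le_rfl) = T := by
    rw [← integral_finsetSum _ fun j _ => A.integrable_pulls E j p]
    simp [sum_pulls]
  refine le_trans ?_ (A.sum_gap_mul_pulls_le E p)
  rw [← hsum, ← Finset.add_sum_erase _ _ (Finset.mem_univ i), add_sub_cancel_left, Finset.mul_sum,
    ← Finset.add_sum_erase _ _ (Finset.mem_univ i)]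
  refine (Finset.sum_le_sum fun j hj => ?_).trans
    (le_add_of_nonneg_left (mul_nonneg (E.gap_nonneg i p) (A.integral_pulls_nonneg E i p)))
  exact mul_le_mul_of_nonneg_right (hD j (Finset.ne_of_mem_erase hj))
    (A.integral_pulls_nonneg E j p)

/-- A lower bound on the expected number of pulls of an arm `i` by a set `S` of players such that
raising the mean rewards of arm `i` for these players gives an `ε`-MPMAB instance. -/
theorem Algorithm.le_sum_pulls (hT : 0 < T) {ε α C D : ℝ} (hC : 0 < C) (A : Algorithm M K T)
    (hA : ∀ E : ProblemInstance M K, E.IsDissimilar ε →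
      A.expectedRegret E ≤ C * (T : ℝ) ^ (1 - α))
    {E : ProblemInstance M K} (hBer : E.IsBernoulli) (hE : E.IsDissimilar ε)
    (hmean : ∀ i p, E.mean i p ∈ Set.Icc (15 / 32 : ℝ) (17 / 32))
    (i : Fin K) (S : Finset (Fin M)) {q : Fin M} (hqS : q ∈ S) (hq : E.gap i q = D) (hD : 0 < D)
    (hS : ∀ p ∈ S, D ≤ E.gap i p)
    (hdis : ∀ p ∈ S, ∀ p', |E.mean i p + 2 * D - (if p' ∈ S then E.mean i p' + 2 * D
      else E.mean i p')| ≤ ε) :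
    Real.log (D * (T : ℝ) ^ α / (8 * C)) / (12 * D ^ 2) ≤
      ∑ p ∈ S, ∫ x, (pulls i p x : ℝ) ∂(A.historyLaw E T le_rfl) := by
  have hP := A.isProbabilityMeasure_historyLaw E T le_rfl
  have hT' : (0 : ℝ) < T := Nat.cast_pos.2 hT
  have : Nonempty (Fin K) := ⟨i⟩
  have hopt (p : Fin M) : E.optMean p ≤ 17 / 32 := ciSup_le fun j => (hmean j p).2
  have hDle : D ≤ 2 / 32 := by
    have h1 := hopt q
    have h2 := (hmean i q).1
    rw [ProblemInstance.gap] at hq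
    linarith
  -- One `D` is absorbed by the gap of `p`, leaving at most `17/32`; the other is at most `2/32`.
  -- Thus the projection defining `b` below is the identity on `S`.
  have hup (p : Fin M) (hp : p ∈ S) : E.mean i p + 2 * D ≤ 19 / 32 := by
    have h1 := hopt p
    have h2 := hS p hp
    rw [ProblemInstance.gap] at h2
    linarith
  let b (p : Fin M) : unitInterval := Set.projIcc 0 1 zero_le_one (E.mean i p + 2 * D)
  have hb (p : Fin M) (hp : p ∈ S) : (b p : ℝ) = E.mean i p + 2 * D := by
    have h1 := (hmean i p).1
    have h2 := hup p hp
    rw [show b p = _ from Set.projIcc_of_mem zero_le_one ⟨by linarith, by linarith⟩]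
  have hb' (p : Fin M) (hp : p ∈ S) : (b p : ℝ) ∈ Set.Icc (E.mean i p) (19 / 32) := by
    rw [hb p hp]
    exact ⟨by linarith, hup p hp⟩
  have hdens := ProblemInstance.isDensity_modify hBer hmean hb'
  obtain ⟨hint, hlog⟩ := A.le_integral_log_modifyRatio (c := 12 * D ^ 2) hBer hmean hb'
    (fun p hp => by rw [hb p hp]; exact le_of_eq (by ring))
  set w := E.modifyRatio i S b
  set E' := E.modify i S b
  have hP' := A.isProbabilityMeasure_historyLaw E' T le_rfl
  have hdis' : E'.IsDissimilar ε := by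
    intro p p' j
    rw [ProblemInstance.mean_modify, ProblemInstance.mean_modify]
    by_cases hj : j = i
    · subst hj
      by_cases hp : p ∈ S <;> by_cases hp' : p' ∈ S
      · simpa [hp, hp', hb] using hdis p hp p'
      · simpa [hp, hp', hb] using hdis p hp p'
      · rw [abs_sub_comm]
        simpa [hp, hp', hb] using hdis p' hp' p
      · simpa [hp, hp'] using hE p p' j
    · simpa [hj] using hE p p' j
  have hgap' (j : Fin K) (hj : j ≠ i) : D ≤ E'.gap j q := by
    have h1 := E'.mean_le_optMean i q
    have h2 := E.mean_le_optMean j q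
    rw [ProblemInstance.mean_modify, if_pos ⟨rfl, hqS⟩, hb q hqS] at h1
    rw [ProblemInstance.gap, ProblemInstance.mean_modify, if_neg (by simp [hj])]
    rw [ProblemInstance.gap] at hq
    linarith
  have hR := (A.gap_mul_pulls_le E i q).trans (hA E hE)
  have hR' := (A.mul_sub_pulls_le E' i q hgap').trans (hA E' hdis')
  -- The test function is the fraction of rounds in which `q` pulls `i`, rather than the indicator
  -- of a majority. Its two error terms are directly the regret bounds `hR` and `hR'`, without
  -- Markov's inequality.
  have hBH := bretagnolle_huber (μ := A.historyLaw E T le_rfl) (ν := A.historyLaw E' T le_rfl)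
    (L := fun x => ∏ s, roundRatio w (x s)) (f := fun x => (pulls i q x : ℝ) / T)
    (Finset.measurable_prod _ fun s _ =>
      (measurable_roundRatio hdens.measurable).comp (measurable_pi_apply s))
    (fun x => Finset.prod_pos fun s _ => hdens.roundRatio_pos _)
    (hdens.historyLaw_eq_withDensity A T le_rfl) hint ((measurable_pulls i q).div_const _)
    (fun x => by positivity) (fun x => (div_le_one hT').2 (pulls_le i q x))
  rw [integral_div, integral_sub (integrable_const _) ((A.integrable_pulls E' i q).div_const _),
    integral_div] at hBH
  simp only [integral_const, probReal_univ, smul_eq_mul, mul_one] at hBH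
  rw [hq] at hR
  set N := ∑ p ∈ S, ∫ x, (pulls i p x : ℝ) ∂(A.historyLaw E T le_rfl)
  set n := ∫ x, (pulls i q x : ℝ) ∂(A.historyLaw E T le_rfl)
  set n' := ∫ x, (pulls i q x : ℝ) ∂(A.historyLaw E' T le_rfl)
  have hTα : 0 < (T : ℝ) ^ α := Real.rpow_pos_of_pos hT' α
  rw [Real.rpow_sub hT', Real.rpow_one] at hR hR'
  have h1 : Real.exp (-(12 * D ^ 2 * N)) / 2 ≤ n / T + (1 - n' / T) :=
    le_trans (by gcongr) hBH
  have h2 : D * T * (n / T + (1 - n' / T)) ≤ 2 * (C * (T / (T : ℝ) ^ α)) := by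
    have : D * T * (n / T + (1 - n' / T)) = D * n + D * (T - n') := by field_simp
    linarith
  have h3 : D * T * (Real.exp (-(12 * D ^ 2 * N)) / 2) ≤ 2 * (C * (T / (T : ℝ) ^ α)) :=
    (mul_le_mul_of_nonneg_left h1 (by positivity)).trans h2
  have h4 : D * (T : ℝ) ^ α / (8 * C) ≤ Real.exp (12 * D ^ 2 * N) := by
    rw [Real.exp_neg] at h3
    set X := Real.exp (12 * D ^ 2 * N)
    have hX : 0 < X := Real.exp_pos _
    have h5 : D * T * (X⁻¹ / 2) * (2 * X * (T : ℝ) ^ α / T) = D * (T : ℝ) ^ α := by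
      field_simp
    have h6 : 2 * (C * (T / (T : ℝ) ^ α)) * (2 * X * (T : ℝ) ^ α / T) = 4 * C * X := by
      field_simp
      ring
    have h7 := mul_le_mul_of_nonneg_right h3 (show 0 ≤ 2 * X * (T : ℝ) ^ α / T by positivity)
    rw [h5, h6] at h7
    rw [div_le_iff₀ (by positivity)]
    -- `h7` already gives the bound with `4 * C`; the constant `8 * C` leaves a factor of two to
    -- spare.
    nlinarith [mul_pos hC hX]
  rw [div_le_iff₀ (by positivity), mul_comm N]
  exact (Real.log_le_iff_le_exp (by positivity)).2 h4

end MPMAB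

end

/-! ### Assembling the regret bound arm by arm -/

theorem theorem3 (M K T : ℕ) (hT : 0 < T) (ε α C : ℝ) (hε : 0 ≤ ε) (hα : 0 < α) (hC : 0 < C)
    (A : MPMAB.Algorithm M K T)
    (hA : ∀ E : MPMAB.ProblemInstance M K, E.IsDissimilar ε →
      A.expectedRegret E ≤ C * (T : ℝ) ^ (1 - α))
    (E : MPMAB.ProblemInstance M K) (hBer : E.IsBernoulli) (hE : E.IsDissimilar (ε / 2))
    (hmean : ∀ i p, E.mean i p ∈ Set.Icc (15 / 32 : ℝ) (17 / 32)) :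
    (∑ i ∈ (E.subparArms (ε / 20))ᶜ, ∑ p : Fin M with 0 < E.gap i p,
        Real.log (E.gap i p * (T : ℝ) ^ α / (8 * C)) / (12 * E.gap i p))
      + (∑ i ∈ E.subparArms (ε / 20) with 0 < E.minGap i,
        Real.log (E.minGap i * (T : ℝ) ^ α / (8 * C)) / (12 * E.minGap i))
      ≤ A.expectedRegret E := by
  have hE' : E.IsDissimilar ε := fun p q i => (hE p q i).trans (by linarith)
  -- Each pull costs at least `D`, which turns the `D ^ 2` of the pull bound into the `D` of the
  -- regret bound.
  have hscale {D L N : ℝ} (hD : 0 < D) (h : L / (12 * D ^ 2) ≤ N) : L / (12 * D) ≤ D * N := by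
    refine le_trans (le_of_eq ?_) (mul_le_mul_of_nonneg_left h hD.le)
    field_simp
  have hterm (i : Fin K) (p : Fin M) := mul_nonneg (E.gap_nonneg i p)
    (A.integral_pulls_nonneg E i p)
  rw [MPMAB.Algorithm.expectedRegret, Finset.sum_comm,
    ← Finset.sum_compl_add_sum (E.subparArms (ε / 20))]
  refine add_le_add (Finset.sum_le_sum fun i hi => ?_) ?_
  · have hi' (p : Fin M) : E.gap i p ≤ ε / 4 := by
      have h : ∀ p, E.optMean p - E.mean i p ≤ 5 * (ε / 20) := by
        simpa only [MPMAB.ProblemInstance.subparArms, Finset.mem_compl, Finset.mem_filter,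
          Finset.mem_univ, true_and, not_exists, not_lt, gt_iff_lt] using hi
      rw [MPMAB.ProblemInstance.gap]
      linarith [h p]
    refine le_trans (Finset.sum_le_sum fun p hp => ?_)
      (Finset.sum_le_sum_of_subset_of_nonneg (Finset.filter_subset _ _) fun p _ _ => hterm i p)
    have hgap : 0 < E.gap i p := (Finset.mem_filter.1 hp).2
    refine hscale hgap ?_
    have h := A.le_sum_pulls hT hC hA hBer hE' hmean i {p} (Finset.mem_singleton_self p) rfl hgap
      (fun p' hp' => by rw [Finset.mem_singleton.1 hp']) (fun p₁ hp₁ p' => by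
        obtain rfl := Finset.mem_singleton.1 hp₁
        split_ifs with hp'
        · rw [Finset.mem_singleton.1 hp']
          simpa using hε
        -- The difference of the original means is at most `ε/2` in absolute value, and the shift of
        -- `p₁` alone adds at most `2 * (ε/4)`.
        · have h1 := abs_le.1 (hE p₁ p' i)
          rw [abs_le]
          constructor <;> linarith [h1.1, h1.2, hi' p₁])
    simpa using h
  · refine le_trans (Finset.sum_le_sum fun i hi => ?_)
      (Finset.sum_le_sum_of_subset_of_nonneg (Finset.filter_subset _ _) fun i _ _ =>
        Finset.sum_nonneg fun p _ => hterm i p)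
    have hmin : 0 < E.minGap i := (Finset.mem_filter.1 hi).2
    -- With no players the infimum defining `minGap` takes the default value `0`, contradicting
    -- `hmin`.
    have hM : Nonempty (Fin M) := by
      by_contra hM
      rw [not_nonempty_iff] at hM
      simp [MPMAB.ProblemInstance.minGap, Real.iInf_of_isEmpty] at hmin
    have hle (p : Fin M) : E.minGap i ≤ E.gap i p := ciInf_le (Set.finite_range _).bddBelow p
    obtain ⟨q, hq⟩ : ∃ q, E.gap i q = E.minGap i := exists_eq_ciInf_of_finite
    refine (hscale hmin (A.le_sum_pulls hT hC hA hBer hE' hmean i Finset.univ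
      (Finset.mem_univ q) hq hmin (fun p _ => hle p) fun p _ p' => ?_)).trans ?_
    · rw [if_pos (Finset.mem_univ p'), add_sub_add_right_eq_sub]
      exact hE' p p' i
    · rw [Finset.mul_sum]
      exact Finset.sum_le_sum fun p _ => mul_le_mul_of_nonneg_right (hle p)
        (A.integral_pulls_nonneg E i p)
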